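/- An arena is a directed graph on a countable (possibly infinite) vertex set $V$, in which every vertex has an outgoing edge, together with a partition of $V$ into the vertices controlled by Eve and those controlled by Adam. A play $\pi=\pi_0\pi_1\ldots$ is an infinite path, formed by letting the owner of the current vertex choose the next edge. A strategy of a player maps every finite history ending in a vertex of that player to a successor of this vertex; it is winning from a set $U\subseteq V$ if every play starting in $U$ and consistent with it is won by that player, and the winning set of a player is the set of vertices from which the player has a winning strategy. A memory structure $(M,m_0,\mu)$ consists of a set $M$ of memory states, an initial state $m_0\in M$ and an update function $\mu$ that maps the current memory state and the edge just taken to the next memory state. A strategy uses this memory structure if its moves depend only on the current vertex and the current memory state; it is positional if its moves depend only on the current vertex. For $F\subseteq V$ and $N\in\mathbb N$, the uniform Büchi game with bound $N$ is the game in which Eve wins a play $\pi$ if and only if $\limsup_{k}\mathrm{dist}_k(\pi,F)\le N$, where $\mathrm{dist}_k(\pi,F)=\inf\{k'-k \mid k'\ge k,\ \pi_{k'}\in F\}\in\mathbb N\cup\{\infty\}$ (with $\inf\emptyset=\infty$), and Adam wins otherwise. Proposition (Strategy complexity for uniform Büchi games). For every arena, every $F\subseteq V$ and every $N\in\mathbb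 N$, the following hold in the uniform Büchi game with bound $N$: 1. Eve has a positional strategy that is winning from her whole winning set. 2. Adam has a strategy that is winning from his whole winning set and uses a single memory structure with $N+1$ memory states. Moreover: 3. In general, Adam needs at least $N-1$ memory states, even over finite arenas: for every $N\ge 2$ there are a finite arena, a set $F$ of its vertices and a vertex $v_0$ in Adam's winning set such that every memory structure with finitely many states that is used by some strategy of Adam winning from $v_0$ has at least $N-1$ memory states. -/

import Mathlib

open Filter

universe u w

/-- The two players. -/
inductive Player : Type where
  | eve : Player
  | adam : Player

/-- An arena on the vertex set `V`: a directed graph without dead-ends, together with a partition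
of its vertices, given by the player `owner v` who controls the vertex `v`. -/
structure Arena (V : Type u) where
  owner : V → Player
  Edge : V → V → Prop
  exists_edge : ∀ v, ∃ v', Edge v v'

namespace Arena

variable {V : Type u}

/-- A strategy for the player `p`: `next h v` is the move prescribed at the current vertex `v`
after the finite history `h`, the list of the earlier vertices, the most recent one first.
Its values at vertices that `p` does not control are irrelevant. -/
structure Strategy (A : Arena V) (p : Player) where
  next : List V → V → V
  legal : ∀ h v, A.owner v = p → A.Edge v (next h v)

/-- The move made at `v` after the history `h` when both strategies are followed. -/
def move (A : Arena V) (σ : A.Strategy Player.eve) (τ : A.Strategy Player.adam)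
    (h : List V) (v : V) : V :=
  match A.owner v with
  | Player.eve => σ.next h v
  | Player.adam => τ.next h v

/-- The history before time `n` (most recent vertex first) and the vertex at time `n`,
when `σ` and `τ` are played from `v₀`. -/
def stage (A : Arena V) (σ : A.Strategy Player.eve) (τ : A.Strategy Player.adam) (v₀ : V) :
    ℕ → List V × V
  | 0 => ([], v₀)
  | n + 1 =>
    let s := stage A σ τ v₀ n
    (s.2 :: s.1, A.move σ τ s.1 s.2)

/-- The unique play `π(v₀, σ, τ)`. -/
def play (A : Arena V) (σ : A.Strategy Player.eve) (τ : A.Strategy Player.adam) (v₀ : V) (n : ℕ) :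
    V :=
  (A.stage σ τ v₀ n).2

/-- Eve's strategy `σ` is winning from `U` for the condition `Ω`. -/
def EveWins (A : Arena V) (Ω : Set (ℕ → V)) (σ : A.Strategy Player.eve) (U : Set V) : Prop :=
  ∀ v₀ ∈ U, ∀ τ : A.Strategy Player.adam, A.play σ τ v₀ ∈ Ω

/-- Adam's strategy `τ` is winning from `U` in the game where Eve's condition is `Ω`
(so that Adam's condition is the complement of `Ω`). -/
def AdamWins (A : Arena V) (Ω : Set (ℕ → V)) (τ : A.Strategy Player.adam) (U : Set V) : Prop :=
  ∀ v₀ ∈ U, ∀ σ : A.Strategy Player.eve, A.play σ τ v₀ ∉ Ω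

/-- The vertices from which Eve has a winning strategy. -/
def eveWinningSet (A : Arena V) (Ω : Set (ℕ → V)) : Set V :=
  {v | ∃ σ : A.Strategy Player.eve, A.EveWins Ω σ {v}}

/-- The vertices from which Adam has a winning strategy. -/
def adamWinningSet (A : Arena V) (Ω : Set (ℕ → V)) : Set V :=
  {v | ∃ τ : A.Strategy Player.adam, A.AdamWins Ω τ {v}}

end Arena

/-- A memory structure with set of memory states `M`, which reads the edges taken.
The value of `update` at pairs of vertices that are not edges is irrelevant. -/
structure MemoryStructure (V : Type u) (M : Type w) where
  init : M
  update : M → V × V → M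

/-- The memory state reached at the current vertex after a history (most recent vertex first). -/
def MemoryStructure.state {V : Type u} {M : Type w} (μ : MemoryStructure V M) : List V → V → M
  | [], _ => μ.init
  | v :: h, v' => μ.update (μ.state h v) (v, v')

namespace Arena.Strategy

variable {V : Type u} {A : Arena V} {p : Player}

/-- The strategy relies on the memory structure `μ`: its moves are given by a next-move function
of the current vertex and the current memory state only. -/
def UsesMemory {M : Type w} (σ : A.Strategy p) (μ : MemoryStructure V M) : Prop :=
  ∃ ν : V → M → V, ∀ h v, A.owner v = p → σ.next h v = ν v (μ.state h v)

/-- The strategy is positional (memoryless): its moves depend on the current vertex only. -/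
def IsPositional (σ : A.Strategy p) : Prop :=
  ∃ f : V → V, ∀ h v, A.owner v = p → σ.next h v = f v

end Arena.Strategy

/-- The waiting time `dist_k(π, F) = inf {k' - k | k' ≥ k, π k' ∈ F}`, which is `⊤` if `F` is
not visited from time `k` on. -/
noncomputable def waitingTime {V : Type u} (F : Set V) (π : ℕ → V) (k : ℕ) : ℕ∞ :=
  sInf {d | ∃ k', k ≤ k' ∧ π k' ∈ F ∧ d = ((k' - k : ℕ) : ℕ∞)}

/-- The uniform Büchi condition with Büchi set `F` and bound `N`. -/
def uniformBuchi {V : Type u} (F : Set V) (N : ℕ) : Set (ℕ → V) :=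
  {π | limsup (fun k => waitingTime F π k) atTop ≤ (N : ℕ∞)}

/-! The upper bounds come from progress measures. Eve's measure assigns to a vertex an ordinal that
never increases and a counter that bounds the wait for `F` while the ordinal is constant; following
any measure is positional and wins wherever the ordinal is not `⊤`. Take the least measure and let
`L` be the set where it is `⊤`. Adam can stay in `L`, and a second measure, on `L` times the `N + 1`
budgets, describes how he forces overruns of the budget again and again. If its least solution were
`⊤` somewhere, the smallest such budgets would give Eve counters at a fresh ordinal level,
contradicting leastness (`exists_measure_adam_wins`). So each vertex is won by one of two fixed
strategies.

For the lower bound, Adam wins the delay arena by raising the delay by one each time Eve resets, and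
each delay that he never uses gives Eve a threshold strategy (`le_card_memory`). -/

theorem mem_uniformBuchi_iff {V : Type u} {F : Set V} {N : ℕ} {π : ℕ → V} :
    π ∈ uniformBuchi F N ↔ ∃ k₀, ∀ k, k₀ ≤ k → ∃ j, j ≤ N ∧ π (k + j) ∈ F := by
  have key : ∀ k, waitingTime F π k < ((N + 1 : ℕ) : ℕ∞) ↔ ∃ j, j ≤ N ∧ π (k + j) ∈ F := by
    intro k
    unfold waitingTime
    rw [sInf_lt_iff]
    constructor
    · rintro ⟨_, ⟨k', hk, hF, rfl⟩, hlt⟩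
      have : k' - k < N + 1 := by exact_mod_cast hlt
      exact ⟨k' - k, by omega, by rwa [Nat.add_sub_cancel' hk]⟩
    · rintro ⟨j, hj, hF⟩
      refine ⟨_, ⟨k + j, by omega, hF, rfl⟩, ?_⟩
      exact_mod_cast (by omega : k + j - k < N + 1)
  unfold uniformBuchi
  rw [Set.mem_ofPred_eq]
  constructor
  · intro h
    have h1 : limsup (fun k => waitingTime F π k) atTop < ((N + 1 : ℕ) : ℕ∞) :=
      lt_of_le_of_lt h (by exact_mod_cast Nat.lt_succ_self N)
    obtain ⟨k₀, hk₀⟩ := eventually_atTop.1 (eventually_lt_of_limsup_lt h1)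
    exact ⟨k₀, fun k hk => (key k).1 (hk₀ k hk)⟩
  · rintro ⟨k₀, hk₀⟩
    refine limsup_le_of_le (by isBoundedDefault) (eventually_atTop.2 ⟨k₀, fun k hk => ?_⟩)
    have := (key k).2 (hk₀ k hk)
    rw [Nat.cast_add, Nat.cast_one] at this
    exact Order.le_of_lt_add_one this

/-- Plays along which a rank bounded by `N` decreases outside `F` satisfy the condition. -/
theorem mem_uniformBuchi_of_rank {V : Type u} {F : Set V} {N : ℕ} {π : ℕ → V} (c : ℕ → ℕ) (k₀ : ℕ)
    (hN : ∀ k, k₀ ≤ k → c k ≤ N) (hc : ∀ k, k₀ ≤ k → π k ∈ F ∨ c (k + 1) < c k) :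
    π ∈ uniformBuchi F N := by
  rw [mem_uniformBuchi_iff]
  refine ⟨k₀, ?_⟩
  have key : ∀ n k, k₀ ≤ k → c k ≤ n → ∃ j, j ≤ n ∧ π (k + j) ∈ F := by
    intro n
    induction n with
    | zero =>
      intro k hk h
      rcases hc k hk with h' | h'
      · exact ⟨0, le_rfl, h'⟩
      · omega
    | succ n ih =>
      intro k hk h
      rcases hc k hk with h' | h'
      · exact ⟨0, by omega, h'⟩
      · obtain ⟨j, hj, hF⟩ := ih (k + 1) (by omega) (by omega)
        exact ⟨j + 1, by omega, by rwa [add_comm j 1, ← add_assoc]⟩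
  exact fun k hk => key N k hk (hN k hk)

theorem exists_ordinal_bound {P : Type u} (g : P → WithTop Ordinal.{u}) :
    ∃ β : Ordinal.{u}, ∀ x, g x ≠ ⊤ → g x < β := by
  refine ⟨⨆ x, Order.succ ((g x).untopD 0), fun x hx => ?_⟩
  obtain ⟨a, ha⟩ := WithTop.ne_top_iff_exists.1 hx
  rw [← ha, WithTop.coe_lt_coe]
  refine lt_of_lt_of_le (Order.lt_succ a) ?_
  have := Ordinal.le_iSup (fun x => Order.succ ((g x).untopD 0)) x
  simpa [← ha] using this

/-! ### Progress measures and their least elements -/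

/-- A local progress condition for a protagonist moving on a graph: `allowed x o o'` says that the
measure may pass from `o` at `x` to `o'` at a successor of `x`. -/
structure ProgressGame (P : Type u) (O : Type w) [LinearOrder O] where
  ctrl : P → Prop
  edge : P → P → Prop
  live : O → Prop
  dead : O
  not_live_dead : ¬ live dead
  allowed : P → O → O → Prop
  allowed_anti : ∀ x o o₁ o₂, o₂ ≤ o₁ → allowed x o o₁ → allowed x o o₂

namespace ProgressGame

variable {P : Type u} {O : Type w} [LinearOrder O] (G : ProgressGame P O)

/-- With value `o` at `x`, the protagonist can progress with respect to `ρ`. -/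
def Step (ρ : P → O) (x : P) (o : O) : Prop :=
  (G.ctrl x → ∃ y, G.edge x y ∧ G.allowed x o (ρ y)) ∧
    (¬ G.ctrl x → ∀ y, G.edge x y → G.allowed x o (ρ y))

/-- Progress measures. -/
def IsMeasure (ρ : P → O) : Prop :=
  ∀ x, G.live (ρ x) → G.Step ρ x (ρ x)

variable {G}

theorem Step.anti {ρ ρ' : P → O} (h : ρ' ≤ ρ) {x : P} {o : O} (hs : G.Step ρ x o) :
    G.Step ρ' x o :=
  ⟨fun hc => let ⟨y, hy, ha⟩ := hs.1 hc; ⟨y, hy, G.allowed_anti _ _ _ _ (h y) ha⟩,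
    fun hc y hy => G.allowed_anti _ _ _ _ (h y) (hs.2 hc y hy)⟩

variable (G) in
-- The pointwise minimum of all measures works: at each vertex the minimum is attained by some
-- measure, whose step survives when the values at the successors are lowered.
theorem exists_least_measure [WellFoundedLT O] :
    ∃ ρ, G.IsMeasure ρ ∧ ∀ ρ', G.IsMeasure ρ' → ρ ≤ ρ' := by
  have hne : G.IsMeasure fun _ => G.dead := fun x hx => absurd hx G.not_live_dead
  have hmin : ∀ x, ∃ ρ, G.IsMeasure ρ ∧ ∀ ρ', G.IsMeasure ρ' → ρ x ≤ ρ' x := by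
    intro x
    obtain ⟨_, ⟨ρ, hρ, rfl⟩, hm⟩ := WellFounded.has_min (wellFounded_lt (α := O))
      ((fun ρ : P → O => ρ x) '' {ρ | G.IsMeasure ρ}) ⟨_, _, hne, rfl⟩
    exact ⟨ρ, hρ, fun ρ' h' => not_lt.1 (hm _ ⟨ρ', h', rfl⟩)⟩
  choose r hr hle using hmin
  refine ⟨fun x => r x x, fun x hx => ?_, fun ρ' h' x => hle x ρ' h'⟩
  exact (hr x x hx).anti fun y => hle y _ (hr x)

/-- Otherwise lowering the value at `x` alone to `o` would give a measure that is not above `ρ`. -/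
theorem le_of_step {ρ : P → O} (hρ : G.IsMeasure ρ) (hl : ∀ ρ', G.IsMeasure ρ' → ρ ≤ ρ')
    {x : P} {o : O} (h : G.Step ρ x o) : ρ x ≤ o := by
  classical
  by_contra! hlt
  have hle : Function.update ρ x o ≤ ρ := by
    intro y
    by_cases hy : y = x
    · subst hy; simpa using hlt.le
    · simp [hy]
  have hm : G.IsMeasure (Function.update ρ x o) := by
    intro y hy
    by_cases hyx : y = x
    · subst hyx
      simpa using h.anti hle
    · simp only [Function.update_of_ne hyx] at hy ⊢
      exact (hρ y hy).anti hle
  have := hl _ hm x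
  simp only [Function.update_self] at this
  exact absurd hlt (not_lt.2 this)

end ProgressGame

/-! ### Plays and the strategies induced by measures -/

namespace Arena

variable {V : Type u} {A : Arena V}

theorem play_succ_eve {σ : A.Strategy Player.eve} {τ : A.Strategy Player.adam} {v₀ : V} {n : ℕ}
    (h : A.owner (A.play σ τ v₀ n) = Player.eve) :
    A.play σ τ v₀ (n + 1) = σ.next (A.stage σ τ v₀ n).1 (A.play σ τ v₀ n) := by
  unfold play at h ⊢
  simp only [stage, move, h]

theorem play_succ_adam {σ : A.Strategy Player.eve} {τ : A.Strategy Player.adam} {v₀ : V} {n : ℕ}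
    (h : A.owner (A.play σ τ v₀ n) = Player.adam) :
    A.play σ τ v₀ (n + 1) = τ.next (A.stage σ τ v₀ n).1 (A.play σ τ v₀ n) := by
  unfold play at h ⊢
  simp only [stage, move, h]

theorem owner_eq_adam {v : V} (h : A.owner v ≠ Player.eve) : A.owner v = Player.adam := by
  cases h' : A.owner v
  · exact absurd h' h
  · rfl

theorem owner_eq_eve {v : V} (h : A.owner v ≠ Player.adam) : A.owner v = Player.eve := by
  cases h' : A.owner v
  · rfl
  · exact absurd h' h

theorem edge_play (σ : A.Strategy Player.eve) (τ : A.Strategy Player.adam) (v₀ : V) (n : ℕ) :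
    A.Edge (A.play σ τ v₀ n) (A.play σ τ v₀ (n + 1)) := by
  by_cases h : A.owner (A.play σ τ v₀ n) = Player.eve
  · rw [play_succ_eve h]
    exact σ.legal _ _ h
  · rw [play_succ_adam (owner_eq_adam h)]
    exact τ.legal _ _ (owner_eq_adam h)

open Classical in
/-- Some legal move, with the property `Q` if this is possible. -/
noncomputable def chooseMove (A : Arena V) (Q : V → V → Prop) (v : V) : V :=
  if h : ∃ v', A.Edge v v' ∧ Q v v' then h.choose else (A.exists_edge v).choose

theorem edge_chooseMove (Q : V → V → Prop) (v : V) : A.Edge v (A.chooseMove Q v) := by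
  unfold chooseMove
  split_ifs with h
  · exact h.choose_spec.1
  · exact (A.exists_edge v).choose_spec

theorem chooseMove_spec {Q : V → V → Prop} {v : V} (h : ∃ v', A.Edge v v' ∧ Q v v') :
    Q v (A.chooseMove Q v) := by
  unfold chooseMove
  rw [dif_pos h]
  exact h.choose_spec.2

/-- Eve's game, measured lexicographically by an ordinal, which must not increase, and a number of
steps within which `F` is visited unless the ordinal drops. -/
def eveGame (A : Arena V) (F : Set V) (N : ℕ) :
    ProgressGame V (WithTop Ordinal.{u} ×ₗ ℕ) where
  ctrl v := A.owner v = Player.eve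
  edge := A.Edge
  live o := (ofLex o).1 ≠ ⊤
  dead := toLex (⊤, 0)
  not_live_dead := by simp
  allowed v o o' := (ofLex o').1 < (ofLex o).1 ∨
    (ofLex o').1 = (ofLex o).1 ∧ (ofLex o').2 ≤ N ∧ (v ∈ F ∨ (ofLex o').2 < (ofLex o).2)
  allowed_anti := by
    intro v o o₁ o₂ hle h
    rcases Prod.Lex.le_iff.1 hle with h1 | ⟨h1, h2⟩
    · rcases h with h | ⟨h, -⟩
      · exact Or.inl (h1.trans h)
      · exact Or.inl (h ▸ h1)
    · rcases h with h | ⟨h, h3, h4⟩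
      · exact Or.inl (h1 ▸ h)
      · exact Or.inr ⟨h1.trans h, h2.trans h3, h4.imp_right (lt_of_le_of_lt h2)⟩

/-- A sequence in a well-order that never increases is eventually constant. -/
theorem _root_.eventually_const_of_nonincreasing {O : Type*} [LinearOrder O] [WellFoundedLT O]
    (a : ℕ → O) (h : ∀ n, a (n + 1) ≤ a n) : ∃ k₀, ∀ k, k₀ ≤ k → a k = a k₀ := by
  have hanti : Antitone a := antitone_nat_of_succ_le h
  obtain ⟨_, ⟨k₀, rfl⟩, hm⟩ := WellFounded.has_min (wellFounded_lt (α := O)) (Set.range a) ⟨_, 0, rfl⟩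
  exact ⟨k₀, fun k hk => le_antisymm (hanti hk) (not_lt.1 (hm _ ⟨k, rfl⟩))⟩

/-- Along a consistent play the ordinal never increases, so it is eventually constant; from then on
the counter is a rank bounded by `N`. -/
theorem exists_positional_of_measure (F : Set V) (N : ℕ) {ρ : V → WithTop Ordinal.{u} ×ₗ ℕ}
    (hρ : (A.eveGame F N).IsMeasure ρ) :
    ∃ σ : A.Strategy Player.eve, σ.IsPositional ∧
      A.EveWins (uniformBuchi F N) σ {v | (ofLex (ρ v)).1 ≠ ⊤} := by
  set Q : V → V → Prop := fun v v' => (A.eveGame F N).allowed v (ρ v) (ρ v') with hQ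
  refine ⟨⟨fun _ v => A.chooseMove Q v, fun _ v _ => edge_chooseMove Q v⟩, ⟨_, fun _ _ _ => rfl⟩, ?_⟩
  intro v₀ hv₀ τ
  set σ : A.Strategy Player.eve :=
    ⟨fun _ v => A.chooseMove Q v, fun _ v _ => edge_chooseMove Q v⟩
  set π := A.play σ τ v₀ with hπ
  have step : ∀ k, (ofLex (ρ (π k))).1 ≠ ⊤ → Q (π k) (π (k + 1)) := by
    intro k hk
    by_cases ho : A.owner (π k) = Player.eve
    · have h1 : π (k + 1) = A.chooseMove Q (π k) := play_succ_eve ho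
      rw [h1]
      exact chooseMove_spec ((hρ _ hk).1 ho)
    · exact (hρ _ hk).2 ho _ (edge_play σ τ v₀ k)
  have fst_le : ∀ k, Q (π k) (π (k + 1)) → (ofLex (ρ (π (k + 1)))).1 ≤ (ofLex (ρ (π k))).1 := by
    intro k h
    rcases h with h | ⟨h, -⟩
    · exact h.le
    · exact h.le
  have live : ∀ k, (ofLex (ρ (π k))).1 ≠ ⊤ := by
    intro k
    induction k with
    | zero => exact hv₀
    | succ k ih => exact ne_top_of_le_ne_top ih (fst_le k (step k ih))
  obtain ⟨k₀, hk₀⟩ := eventually_const_of_nonincreasing (fun k => (ofLex (ρ (π k))).1)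
    fun k => fst_le k (step k (live k))
  have step' : ∀ k, k₀ ≤ k → (ofLex (ρ (π (k + 1)))).2 ≤ N ∧
      (π k ∈ F ∨ (ofLex (ρ (π (k + 1)))).2 < (ofLex (ρ (π k))).2) := by
    intro k hk
    rcases step k (live k) with h | ⟨-, h⟩
    · exact absurd ((hk₀ (k + 1) (by omega)).trans (hk₀ k hk).symm) h.ne
    · exact h
  -- `allowed` bounds the counter only at the successor, hence the shift by one.
  refine mem_uniformBuchi_of_rank (fun k => (ofLex (ρ (π k))).2) (k₀ + 1) ?_ ?_
  · intro k hk
    obtain ⟨k, rfl⟩ : ∃ l, k = l + 1 := ⟨k - 1, by omega⟩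
    exact (step' k (by omega)).1
  · exact fun k hk => (step' k (by omega)).2

open Classical in
/-- The number of further vertices outside `F` that Eve may visit: it is reset to `N` when `F` is
visited and when it is exceeded. -/
noncomputable def nextBudget (F : Set V) (N : ℕ) (v : V) (c : Fin (N + 1)) : Fin (N + 1) :=
  if v ∈ F ∨ (c : ℕ) = 0 then Fin.last N else ⟨c - 1, by omega⟩

/-- Adam's game on the vertices of `L` with a budget: he wants the budget to be exceeded. -/
noncomputable def adamGame (A : Arena V) (F : Set V) (N : ℕ) (L : Set V) :
    ProgressGame (V × Fin (N + 1)) (WithTop Ordinal.{u}) where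
  ctrl x := A.owner x.1 = Player.adam
  edge x y := A.Edge x.1 y.1 ∧ y.1 ∈ L ∧ y.2 = nextBudget F N x.1 x.2
  live o := o ≠ ⊤
  dead := ⊤
  not_live_dead := by simp
  allowed x o o' := (x.1 ∉ F ∧ (x.2 : ℕ) = 0) ∨ o' < o
  allowed_anti := fun _ _ _ _ hle h => h.imp_right (lt_of_le_of_lt hle)

/-- Adam's memory for the uniform Büchi game. -/
noncomputable def budgetMemory (F : Set V) (N : ℕ) : MemoryStructure V (Fin (N + 1)) where
  init := Fin.last N
  update c e := nextBudget F N e.1 c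

/-- The ordinal drops until the budget is overrun, so overruns recur forever. An overrun leaves the
next value unconstrained, which is why `hlive` must cover all of `L` and all budgets. -/
theorem exists_adam_of_measure (F : Set V) (N : ℕ) {L : Set V}
    (heve : ∀ v ∈ L, A.owner v = Player.eve → ∀ v', A.Edge v v' → v' ∈ L)
    {ρ : V × Fin (N + 1) → WithTop Ordinal.{u}} (hρ : (A.adamGame F N L).IsMeasure ρ)
    (hlive : ∀ v ∈ L, ∀ c, ρ (v, c) ≠ ⊤) :
    ∃ τ : A.Strategy Player.adam, τ.UsesMemory (budgetMemory F N) ∧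
      A.AdamWins (uniformBuchi F N) τ L := by
  set Q : Fin (N + 1) → V → V → Prop := fun c v v' => v' ∈ L ∧
    (A.adamGame F N L).allowed (v, c) (ρ (v, c)) (ρ (v', nextBudget F N v c)) with hQ
  have hex : ∀ v ∈ L, A.owner v = Player.adam → ∀ c, ∃ v', A.Edge v v' ∧ Q c v v' := by
    intro v hv ho c
    obtain ⟨⟨v', c'⟩, ⟨h1, h2, h3⟩, h4⟩ := (hρ (v, c) (hlive v hv c)).1 ho
    simp only at h1 h2 h3
    subst h3
    exact ⟨v', h1, h2, h4⟩
  set τ : A.Strategy Player.adam := ⟨fun h v => A.chooseMove (Q ((budgetMemory F N).state h v)) v,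
    fun _ v _ => edge_chooseMove _ v⟩ with hτ
  refine ⟨τ, ⟨fun v c => A.chooseMove (Q c) v, fun _ _ _ => rfl⟩, ?_⟩
  intro v₀ hv₀ σ
  set π := A.play σ τ v₀ with hπ
  set m : ℕ → Fin (N + 1) := fun k => (budgetMemory F N).state (A.stage σ τ v₀ k).1 (π k) with hm
  have hm0 : m 0 = Fin.last N := rfl
  have hm1 : ∀ k, m (k + 1) = nextBudget F N (π k) (m k) := fun k => rfl
  have hnext : ∀ k, π k ∈ L → π (k + 1) ∈ L ∧
      (A.adamGame F N L).allowed (π k, m k) (ρ (π k, m k)) (ρ (π (k + 1), m (k + 1))) := by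
    intro k hk
    by_cases ho : A.owner (π k) = Player.adam
    · have h1 : π (k + 1) = A.chooseMove (Q (m k)) (π k) := play_succ_adam ho
      have h2 := chooseMove_spec (hex _ hk ho (m k))
      rw [← h1] at h2
      rwa [hm1]
    · have h1 := heve _ hk (owner_eq_eve ho) _ (edge_play σ τ v₀ k)
      exact ⟨h1, (hρ _ (hlive _ hk _)).2 ho (π (k + 1), m (k + 1))
        ⟨edge_play σ τ v₀ k, h1, hm1 k⟩⟩
  have hL : ∀ k, π k ∈ L := by
    intro k
    induction k with
    | zero => exact hv₀
    | succ k ih => exact (hnext k ih).1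
  have hbad : ∀ k, ∃ l, k ≤ l ∧ π l ∉ F ∧ (m l : ℕ) = 0 := by
    intro k
    by_contra! hno
    have hdec : ∀ l, ρ (π (k + (l + 1)), m (k + (l + 1))) < ρ (π (k + l), m (k + l)) := by
      intro l
      rcases (hnext (k + l) (hL _)).2 with h | h
      · exact absurd h.2 (hno _ (by omega) h.1)
      · exact h
    obtain ⟨l₀, hl₀⟩ := eventually_const_of_nonincreasing
      (fun l => ρ (π (k + l), m (k + l))) fun l => (hdec l).le
    exact (hdec l₀).ne (hl₀ (l₀ + 1) (by omega))
  -- The `N - m k` vertices just before time `k` exist and lie outside `F`.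
  have hinv : ∀ k, N ≤ k + m k ∧ ∀ j, j < k → k + m k ≤ j + N → π j ∉ F := by
    intro k
    induction k with
    | zero => rw [hm0]; exact ⟨by simp, fun j hj => absurd hj (by omega)⟩
    | succ k ih =>
      rw [hm1]
      unfold nextBudget
      split_ifs with h
      · exact ⟨by simp, fun j hj hj' => by simp at hj'; omega⟩
      · push Not at h
        refine ⟨by have := ih.1; simp only; omega, fun j hj hj' => ?_⟩
        simp only at hj'
        rcases Nat.lt_succ_iff_lt_or_eq.1 hj with h' | rfl
        · exact ih.2 j h' (by omega)
        · exact h.1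
  rw [mem_uniformBuchi_iff]
  rintro ⟨k₀, hk₀⟩
  -- An overrun at time `l` means that the `N + 1` vertices from `l - N` to `l` all avoid `F`; the
  -- offset `N` puts this window after `k₀`.
  obtain ⟨l, hl, hF, hml⟩ := hbad (k₀ + N)
  obtain ⟨j, hj, hjF⟩ := hk₀ (l - N) (by omega)
  rcases Nat.lt_or_ge (l - N + j) l with h | h
  · exact (hinv l).2 _ h (by omega) hjF
  · exact hF ((by omega : l - N + j = l) ▸ hjF)

/-! ### Adam wins where Eve's least measure is infinite -/

theorem exists_measure_adam_wins (A : Arena V) (F : Set V) (N : ℕ) :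
    ∃ ρ : V → WithTop Ordinal.{u} ×ₗ ℕ, (A.eveGame F N).IsMeasure ρ ∧
      ∃ τ : A.Strategy Player.adam, τ.UsesMemory (budgetMemory F N) ∧
        A.AdamWins (uniformBuchi F N) τ {v | (ofLex (ρ v)).1 = ⊤} := by
  classical
  obtain ⟨ρ, hρ, hleast⟩ := (A.eveGame F N).exists_least_measure
  refine ⟨ρ, hρ, ?_⟩
  set L : Set V := {v | (ofLex (ρ v)).1 = ⊤} with hLdef
  have memL : ∀ v, v ∈ L ↔ (ofLex (ρ v)).1 = ⊤ := fun v => Iff.rfl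
  obtain ⟨β, hβ⟩ := exists_ordinal_bound fun v => (ofLex (ρ v)).1
  -- `β` exceeds all ordinals used outside `L`, so any vertex of `L` from which Eve could force
  -- leaving `L` in one step would deserve the value `β`.
  have hnot : ∀ v ∈ L, ∀ c, ¬ (A.eveGame F N).Step ρ v (toLex ((β : WithTop Ordinal), c)) := by
    intro v hv c h
    rcases Prod.Lex.le_iff.1 (ProgressGame.le_of_step hρ hleast h) with h' | h'
    · rw [(memL v).1 hv] at h'
      exact absurd h' (by simp)
    · rw [(memL v).1 hv] at h'
      exact absurd h'.1 (by simp)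
  have heve : ∀ v ∈ L, A.owner v = Player.eve → ∀ v', A.Edge v v' → v' ∈ L := by
    intro v hv ho v' he
    by_contra hv'
    exact hnot v hv 0 ⟨fun _ => ⟨v', he, Or.inl (hβ v' hv')⟩, fun h => absurd ho h⟩
  have hadam : ∀ v ∈ L, A.owner v = Player.adam → ∃ v' ∈ L, A.Edge v v' := by
    intro v hv ho
    by_contra! hno
    refine hnot v hv 0 ⟨fun h => ?_, fun _ v' he => Or.inl (hβ v' fun h => hno v' h he)⟩
    rw [show (A.eveGame F N).ctrl v = (A.owner v = Player.eve) from rfl, ho] at h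
    exact absurd h (by simp)
  obtain ⟨r, hr, hrleast⟩ := (A.adamGame F N L).exists_least_measure
  refine exists_adam_of_measure F N heve hr ?_
  by_contra! hC
  obtain ⟨v₁, hv₁, c₁, hc₁⟩ := hC
  obtain ⟨γ, hγ⟩ := exists_ordinal_bound r
  have hrnot : ∀ x o, r x = ⊤ → ¬ (A.adamGame F N L).Step r x ((o : Ordinal) : WithTop Ordinal) := by
    intro x o hx h
    have := ProgressGame.le_of_step hr hrleast h
    rw [hx] at this
    exact absurd this (by simp)
  -- At an overrun Adam has made progress with any ordinal, even `0`, since he can always stay in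
  -- `L`.
  have hgood : ∀ v ∈ L, ∀ c, r (v, c) = ⊤ → v ∈ F ∨ (c : ℕ) ≠ 0 := by
    intro v hv c hx
    by_contra! hb
    refine hrnot (v, c) 0 hx ⟨fun ho => ?_, fun _ _ _ => Or.inl hb⟩
    obtain ⟨v', hv', he⟩ := hadam v hv ho
    exact ⟨(v', nextBudget F N v c), ⟨he, hv', rfl⟩, Or.inl hb⟩
  have hsuccE : ∀ v ∈ L, ∀ c, r (v, c) = ⊤ → A.owner v = Player.eve →
      ∃ v' ∈ L, A.Edge v v' ∧ r (v', nextBudget F N v c) = ⊤ := by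
    intro v hv c hx ho
    by_contra! hno
    refine hrnot (v, c) γ hx ⟨fun h => ?_, ?_⟩
    · rw [show (A.adamGame F N L).ctrl (v, c) = (A.owner v = Player.adam) from rfl, ho] at h
      exact absurd h (by simp)
    · rintro _ ⟨v', c'⟩ ⟨he, hv', rfl⟩
      exact Or.inr (hγ _ (hno v' hv' he))
  have hsuccA : ∀ v ∈ L, ∀ c, r (v, c) = ⊤ → A.owner v = Player.adam →
      ∀ v' ∈ L, A.Edge v v' → r (v', nextBudget F N v c) = ⊤ := by
    intro v hv c hx ho v' hv' he
    by_contra hno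
    exact hrnot (v, c) γ hx ⟨fun _ => ⟨(v', nextBudget F N v c), ⟨he, hv', rfl⟩,
      Or.inr (hγ _ hno)⟩, fun h => absurd ho h⟩
  set S : V → Prop := fun v => v ∈ L ∧ ∃ c : ℕ, ∃ hc : c < N + 1, r (v, ⟨c, hc⟩) = ⊤ with hS
  -- The least budget `c` with `r (v, c) = ⊤` serves as Eve's counter. The next budget is again `⊤`
  -- at a suitable successor, so the counter there is at most that budget; moves of Adam out of `L`
  -- drop below `β`.
  set ρ' : V → WithTop Ordinal.{u} ×ₗ ℕ := fun v =>
    if h : S v then toLex ((β : WithTop Ordinal), Nat.find h.2) else ρ v with hρ'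
  have hle : ρ' ≤ ρ := by
    intro v
    simp only [hρ']
    split_ifs with h
    · refine Prod.Lex.le_iff.2 (Or.inl ?_)
      rw [(memL v).1 h.1]
      simp
    · exact le_rfl
  have hin : ∀ v c, v ∈ L → r (v, c) = ⊤ →
      (ofLex (ρ' v)).1 = (β : WithTop Ordinal) ∧ (ofLex (ρ' v)).2 ≤ c := by
    intro v c hv hc
    have h : S v := ⟨hv, c, c.2, hc⟩
    simp only [hρ', dif_pos h, ofLex_toLex, true_and]
    exact Nat.find_min' h.2 ⟨c.2, hc⟩
  have hm : (A.eveGame F N).IsMeasure ρ' := by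
    intro v hv
    by_cases h : S v
    · obtain ⟨hc, hct⟩ := Nat.find_spec h.2
      have hval : ρ' v = toLex ((β : WithTop Ordinal), Nat.find h.2) := by simp only [hρ', dif_pos h]
      rw [hval]
      set c := Nat.find h.2
      have hallowed : ∀ v', v' ∈ L → r (v', nextBudget F N v ⟨c, hc⟩) = ⊤ →
          (A.eveGame F N).allowed v (toLex ((β : WithTop Ordinal), c)) (ρ' v') := by
        intro v' hv' hr'
        obtain ⟨h1, h2⟩ := hin v' _ hv' hr'
        refine Or.inr ⟨h1, by omega, ?_⟩
        by_cases hF : v ∈ F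
        · exact Or.inl hF
        · have h0 : c ≠ 0 := (hgood v h.1 ⟨c, hc⟩ hct).resolve_left hF
          right
          rw [nextBudget, if_neg (by simp [hF, h0])] at h2
          simp only [ofLex_toLex] at h2 ⊢
          omega
      refine ⟨fun ho => ?_, fun ho v' he => ?_⟩
      · obtain ⟨v', hv', he, hr'⟩ := hsuccE v h.1 _ hct ho
        exact ⟨v', he, hallowed v' hv' hr'⟩
      · by_cases hv' : v' ∈ L
        · exact hallowed v' hv' (hsuccA v h.1 _ hct (owner_eq_adam ho) v' hv' he)
        · have : ρ' v' = ρ v' := by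
            simp only [hρ']
            rw [dif_neg fun h' => hv' h'.1]
          rw [this]
          exact Or.inl (hβ v' hv')
    · have hval : ρ' v = ρ v := by simp only [hρ', dif_neg h]
      rw [hval] at hv ⊢
      exact (hρ v hv).anti hle
  have h1 := hleast _ hm v₁
  rcases Prod.Lex.le_iff.1 h1 with h' | h' <;>
    rw [(memL v₁).1 hv₁, (hin v₁ c₁ hv₁ hc₁).1] at h'
  · exact absurd h' (by simp)
  · exact absurd h'.1 (by simp)

/-- The two strategies win from complementary sets; playing one against a supposed winning strategy
of the opponent shows that these are the full winning sets. -/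
theorem uniformBuchi_strategies (A : Arena V) (F : Set V) (N : ℕ) :
    (∃ σ : A.Strategy Player.eve, σ.IsPositional ∧
      A.EveWins (uniformBuchi F N) σ (A.eveWinningSet (uniformBuchi F N))) ∧
    (∃ (μ : MemoryStructure V (Fin (N + 1))) (τ : A.Strategy Player.adam), τ.UsesMemory μ ∧
      A.AdamWins (uniformBuchi F N) τ (A.adamWinningSet (uniformBuchi F N))) := by
  obtain ⟨ρ, hρ, τ, hτ, hτw⟩ := exists_measure_adam_wins A F N
  obtain ⟨σ, hσ, hσw⟩ := exists_positional_of_measure F N hρ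
  refine ⟨⟨σ, hσ, ?_⟩, _, τ, hτ, ?_⟩
  · rintro v ⟨σ', hσ'⟩
    exact hσw v fun h => hτw v h σ' (hσ' v rfl τ)
  · rintro v ⟨τ', hτ'⟩
    exact hτw v (by_contra fun h => hτ' v rfl σ (hσw v h τ'))

end Arena

/-! ### The lower bound on Adam's memory -/

/-- Vertices of an arena in which Adam has to choose among `N - 1` delays. -/
inductive DelayVertex (N : ℕ) : Type where
  | wait (k : Fin N) : DelayVertex N
  | choice (j : Fin N) : DelayVertex N
  | reset (j : Fin N) : DelayVertex N
  | detour (k : Fin N) : DelayVertex N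

namespace DelayVertex

variable {N : ℕ}

instance : Finite (DelayVertex N) := by
  refine Finite.of_surjective (α := Fin 4 × Fin N)
    (fun x => match x.1 with
      | 0 => wait x.2
      | 1 => choice x.2
      | 2 => reset x.2
      | 3 => detour x.2) ?_
  rintro (k | k | k | k)
  · exact ⟨(0, k), rfl⟩
  · exact ⟨(1, k), rfl⟩
  · exact ⟨(2, k), rfl⟩
  · exact ⟨(3, k), rfl⟩

/-- The edges of the delay arena. At `wait 0` Adam picks a delay `j ≠ 0`, after which Eve either
visits `F` and comes back to `wait 0` after `j` steps, or takes a detour of length `N - j`. -/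
inductive Edge : DelayVertex N → DelayVertex N → Prop
  | choose (k j : Fin N) (hk : (k : ℕ) = 0) (hj : (j : ℕ) ≠ 0) : Edge (wait k) (choice j)
  | wait (k l : Fin N) (h : (l : ℕ) + 1 = k) : Edge (wait k) (wait l)
  | reset (j : Fin N) : Edge (choice j) (reset j)
  | detour (j k : Fin N) (h : (j : ℕ) + k = N) : Edge (choice j) (detour k)
  | leave (j : Fin N) : Edge (reset j) (wait j)
  | step (k l : Fin N) (h : (l : ℕ) + 1 = k) : Edge (detour k) (detour l)
  | back (k l : Fin N) (hk : (k : ℕ) = 0) (hl : (l : ℕ) = 0) : Edge (detour k) (wait l)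

/-- The Büchi set of the delay arena. -/
def target : DelayVertex N → Prop
  | wait _ => False
  | choice _ => False
  | reset _ => True
  | detour k => (k : ℕ) = 0

/-- The owners of the vertices of the delay arena: Adam controls `wait 0` only. -/
def owner : DelayVertex N → Player
  | wait k => if (k : ℕ) = 0 then Player.adam else Player.eve
  | _ => Player.eve

theorem exists_edge (hN : 2 ≤ N) (v : DelayVertex N) : ∃ v', Edge v v' := by
  rcases v with k | j | j | k
  · by_cases hk : (k : ℕ) = 0
    · exact ⟨_, Edge.choose k ⟨1, by omega⟩ hk one_ne_zero⟩
    · exact ⟨_, Edge.wait k ⟨k - 1, by omega⟩ (by simp only; omega)⟩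
  · exact ⟨_, Edge.reset j⟩
  · exact ⟨_, Edge.leave j⟩
  · by_cases hk : (k : ℕ) = 0
    · exact ⟨_, Edge.back k ⟨0, by omega⟩ hk rfl⟩
    · exact ⟨_, Edge.step k ⟨k - 1, by omega⟩ (by simp only; omega)⟩

/-- The delay arena. -/
def arena (hN : 2 ≤ N) : Arena (DelayVertex N) where
  owner := owner
  Edge := Edge
  exists_edge := exists_edge hN

variable (hN : 2 ≤ N)

/-- If the start were live, the vertices of least ordinal would be governed by the counter alone. A
single counter value at `wait 0` would then have to serve against every delay of Adam, and raising
the delays one by one makes it too small. -/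
theorem start_mem_adamWinningSet :
    wait ⟨0, by omega⟩ ∈ (arena hN).adamWinningSet (uniformBuchi {v | target v} N) := by
  obtain ⟨ρ, hρ, τ, -, hτ⟩ := Arena.exists_measure_adam_wins (arena hN) {v | target v} N
  set F : Set (DelayVertex N) := {v | target v} with hF
  refine ⟨τ, fun v hv => hτ v ?_⟩
  obtain rfl : v = wait ⟨0, by omega⟩ := hv
  rw [Set.mem_ofPred_eq]
  by_contra hlive
  set a : DelayVertex N → WithTop Ordinal.{0} := fun v => (ofLex (ρ v)).1 with ha
  set c : DelayVertex N → ℕ := fun v => (ofLex (ρ v)).2 with hc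
  obtain ⟨v₁, hv₁, hmin⟩ : ∃ v, a v ≠ ⊤ ∧ ∀ v', a v ≤ a v' := by
    obtain ⟨_, ⟨v, rfl⟩, hm⟩ := WellFounded.has_min (wellFounded_lt (α := WithTop Ordinal.{0}))
      (Set.range a) ⟨_, wait ⟨0, by omega⟩, rfl⟩
    have hle : ∀ v', a v ≤ a v' := fun v' => not_lt.1 (hm _ ⟨v', rfl⟩)
    exact ⟨v, ne_top_of_le_ne_top hlive (hle _), hle⟩
  have hstep : ∀ v v', a v = a v₁ → (arena hN |>.eveGame F N).allowed v (ρ v) (ρ v') →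
      a v' = a v₁ ∧ c v' ≤ N ∧ (target v ∨ c v' < c v) := by
    intro v v' hv h
    rcases h with h | ⟨h, h'⟩
    · exact absurd (hmin v') (not_le.2 (lt_of_lt_of_eq h hv))
    · exact ⟨h.trans hv, h'⟩
  have hE : ∀ v, owner v = Player.eve → a v = a v₁ →
      ∃ v', Edge v v' ∧ a v' = a v₁ ∧ c v' ≤ N ∧ (target v ∨ c v' < c v) := by
    intro v ho hv
    obtain ⟨v', he, h⟩ := (hρ v (ne_of_eq_of_ne hv hv₁)).1 ho
    exact ⟨v', he, hstep v v' hv h⟩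
  have hA : ∀ v, owner v = Player.adam → a v = a v₁ →
      ∀ v', Edge v v' → a v' = a v₁ ∧ c v' ≤ N ∧ (target v ∨ c v' < c v) := by
    intro v ho hv v' he
    refine hstep v v' hv ((hρ v (ne_of_eq_of_ne hv hv₁)).2 (fun h => ?_) v' he)
    rw [show (arena hN |>.eveGame F N).ctrl v = (owner v = Player.eve) from rfl, ho] at h
    exact absurd h (by simp)
  have hwait : ∀ k (hk : k < N), a (wait ⟨k, hk⟩) = a v₁ → c (wait ⟨k, hk⟩) ≤ N →
      a (wait ⟨0, by omega⟩) = a v₁ ∧ c (wait ⟨0, by omega⟩) + k ≤ N := by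
    intro k
    suffices h : ∀ n, n ≤ N → ∀ (hk : k < N), a (wait ⟨k, hk⟩) = a v₁ → c (wait ⟨k, hk⟩) ≤ n →
        a (wait ⟨0, by omega⟩) = a v₁ ∧ c (wait ⟨0, by omega⟩) + k ≤ n from h N le_rfl
    induction k with
    | zero => exact fun n _ _ h1 h2 => ⟨h1, h2⟩
    | succ k ih =>
      intro n hn hk h1 h2
      obtain ⟨v', he, h3, -, h5⟩ := hE _ (by simp [owner]) h1
      have h5 := h5.resolve_left id
      cases he with
      | choose _ _ h => exact absurd h (by simp)
      | wait _ l h =>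
        obtain ⟨l, hl⟩ := l
        obtain rfl : l = k := by simpa using h
        obtain ⟨h6, h7⟩ := ih (n - 1) (by omega) (by omega) h3 (by omega)
        exact ⟨h6, by omega⟩
  have hdetour : ∀ k (hk : k < N), a (detour ⟨k, hk⟩) = a v₁ → k ≤ c (detour ⟨k, hk⟩) ∧
      a (wait ⟨0, by omega⟩) = a v₁ ∧ c (wait ⟨0, by omega⟩) ≤ N := by
    intro k
    induction k with
    | zero =>
      intro hk h1
      obtain ⟨v', he, h3, h4, -⟩ := hE _ rfl h1
      cases he with
      | step _ _ h => exact absurd h (by simp)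
      | back _ l _ hl =>
        obtain rfl : l = ⟨0, by omega⟩ := Fin.ext hl
        exact ⟨Nat.zero_le _, h3, h4⟩
    | succ k ih =>
      intro hk h1
      obtain ⟨v', he, h3, -, h5⟩ := hE _ rfl h1
      have h5 := h5.resolve_left (by simp [target])
      cases he with
      | step _ l h =>
        obtain ⟨l, hl⟩ := l
        obtain rfl : l = k := by simpa using h
        obtain ⟨h6, h7⟩ := ih (by omega) h3
        exact ⟨by omega, h7⟩
      | back _ _ h => exact absurd h (by simp)
  have hreset : ∀ j : Fin N, a (reset j) = a v₁ →
      a (wait ⟨0, by omega⟩) = a v₁ ∧ c (wait ⟨0, by omega⟩) + j ≤ N := by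
    intro j hj
    obtain ⟨v', he, h1, h2, -⟩ := hE (reset j) rfl hj
    cases he
    exact hwait j j.2 h1 h2
  have hstart : a (wait ⟨0, by omega⟩) = a v₁ ∧ c (wait ⟨0, by omega⟩) ≤ N := by
    have hchoice : ∀ j : Fin N, a (choice j) = a v₁ →
        a (wait ⟨0, by omega⟩) = a v₁ ∧ c (wait ⟨0, by omega⟩) ≤ N := by
      intro j hj
      obtain ⟨v', he, h1, -⟩ := hE _ rfl hj
      cases he with
      | reset => exact ⟨(hreset j h1).1, by have := (hreset j h1).2; omega⟩
      | detour _ k => exact (hdetour k k.2 h1).2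
    suffices h : ∀ v, a v = a v₁ → a (wait ⟨0, by omega⟩) = a v₁ ∧ c (wait ⟨0, by omega⟩) ≤ N from
      h v₁ rfl
    rintro (k | j | j | k) h1
    · by_cases hk : (k : ℕ) = 0
      · exact hchoice ⟨1, by omega⟩
          (hA _ (by simp [owner, hk]) h1 _ (Edge.choose k ⟨1, by omega⟩ hk one_ne_zero)).1
      · obtain ⟨v', he, h3, h4, -⟩ := hE _ (by simp [owner, hk]) h1
        cases he with
        | choose _ _ h => exact absurd h hk
        | wait _ l =>
          obtain ⟨h5, h6⟩ := hwait l l.2 h3 h4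
          exact ⟨h5, by omega⟩
    · exact hchoice j h1
    · exact ⟨(hreset j h1).1, by have := (hreset j h1).2; omega⟩
    · exact (hdetour k k.2 h1).2
  have hinc : ∀ i, i < N → c (wait ⟨0, by omega⟩) + i ≤ N := by
    intro i
    induction i with
    | zero => exact fun _ => hstart.2
    | succ i ih =>
      intro hi
      have h0 := ih (by omega)
      obtain ⟨h1, -, h2⟩ := hA _ (by simp [owner]) hstart.1 _
        (Edge.choose ⟨0, by omega⟩ ⟨i + 1, hi⟩ rfl (by simp))
      have h2 := h2.resolve_left id
      obtain ⟨v', he, h3, -, h4⟩ := hE _ rfl h1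
      have h4 := h4.resolve_left id
      cases he with
      | reset => exact (hreset _ h3).2
      | detour _ k h =>
        have := (hdetour k k.2 h3).1
        simp only at h
        simp only [Fin.eta] at this
        omega
  -- This leaves a counter of at most `1`, but it must drop twice, on entering and on leaving
  -- `choice 1`.
  have h0 := hinc (N - 1) (by omega)
  obtain ⟨h1, -, h2⟩ := hA _ (by simp [owner]) hstart.1 _
    (Edge.choose ⟨0, by omega⟩ ⟨1, by omega⟩ rfl (by simp))
  have h2 := h2.resolve_left id
  obtain ⟨v', he, h3, -, h4⟩ := hE _ rfl h1
  have h4 := h4.resolve_left id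
  omega

/-- With fewer states some delay `j` is never chosen at `wait 0`. Eve then resets on delays below
`j` and detours on delays above `j`: a return after a reset is short enough to leave time for any
detour she takes. -/
theorem le_card_memory {M : Type w} [Fintype M] (μ : MemoryStructure (DelayVertex N) M)
    (τ : (arena hN).Strategy Player.adam) (hτ : τ.UsesMemory μ)
    (hw : (arena hN).AdamWins (uniformBuchi {v | target v} N) τ {wait ⟨0, by omega⟩}) :
    N - 1 ≤ Fintype.card M := by
  classical
  obtain ⟨ν, hν⟩ := hτ
  by_contra! hlt
  obtain ⟨j, hj0, hj⟩ : ∃ j : Fin N, (j : ℕ) ≠ 0 ∧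
      ∀ m, ν (wait ⟨0, by omega⟩) m ≠ choice j := by
    by_contra! hno
    have hno' : ∀ i : Fin (N - 1), ∃ m, ν (wait ⟨0, by omega⟩) m = choice ⟨i + 1, by omega⟩ :=
      fun i => hno ⟨i + 1, by omega⟩ (by simp)
    choose f hf using hno'
    have hinj : Function.Injective f := by
      intro i i' h
      have := (hf i).symm.trans ((congrArg _ h).trans (hf i'))
      simp only [choice.injEq, Fin.mk.injEq] at this
      exact Fin.ext (by omega)
    have := Fintype.card_le_of_injective f hinj
    simp only [Fintype.card_fin] at this
    omega
  set Q : DelayVertex N → DelayVertex N → Prop := fun v v' => match v, v' with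
    | choice i, reset _ => i < j
    | choice i, detour _ => j < i
    | _, _ => True with hQ
  set σ : (arena hN).Strategy Player.eve :=
    ⟨fun _ v => (arena hN).chooseMove Q v, fun _ v _ => Arena.edge_chooseMove Q v⟩
  refine hw _ rfl σ ?_
  set π := (arena hN).play σ τ (wait ⟨0, by omega⟩) with hπ
  set good : DelayVertex N → Prop := fun v => match v with
    | wait k => k < j
    | choice i => i ≠ j ∧ (i : ℕ) ≠ 0
    | reset i => i < j
    | detour _ => True with hgood
  set c : DelayVertex N → ℕ := fun v => match v with
    | wait k => N - j + 1 + k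
    | choice _ => N - j
    | reset _ => 0
    | detour k => k with hc
  have hstep : ∀ k, good (π k) → good (π (k + 1)) ∧ (target (π k) ∨ c (π (k + 1)) < c (π k)) := by
    intro k hk
    have he : Edge (π k) (π (k + 1)) := Arena.edge_play σ τ _ k
    have hmoveE : owner (π k) = Player.eve → π (k + 1) = (arena hN).chooseMove Q (π k) :=
      fun ho => Arena.play_succ_eve ho
    have hmoveA : owner (π k) = Player.adam → ∃ m, π (k + 1) = ν (π k) m :=
      fun ho => ⟨_, (Arena.play_succ_adam ho).trans (hν _ _ ho)⟩
    generalize π k = v at *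
    generalize π (k + 1) = v' at *
    have hchoice : ∀ i, v = choice i → Q v v' := by
      rintro i rfl
      rw [hmoveE rfl]
      refine Arena.chooseMove_spec ?_
      rcases lt_or_gt_of_ne hk.1 with h | h
      · exact ⟨_, Edge.reset i, h⟩
      · exact ⟨_, Edge.detour i ⟨N - i, by have := hk.2; omega⟩ (by simp only; omega), h⟩
    cases he with
    | choose k i hk0 hi =>
      obtain ⟨m, hm⟩ := hmoveA (by simp [owner, hk0])
      rw [show k = ⟨0, by omega⟩ from Fin.ext hk0] at hm
      refine ⟨⟨?_, hi⟩, Or.inr ?_⟩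
      · rintro rfl
        exact hj m hm.symm
      · simp only [hc]; omega
    | wait k l h =>
      simp only [hgood, hc, Fin.lt_def] at hk ⊢
      omega
    | reset i =>
      have := hchoice i rfl
      refine ⟨this, Or.inr ?_⟩
      simp only [hc]; omega
    | detour i k h =>
      have : j < i := hchoice i rfl
      refine ⟨trivial, Or.inr ?_⟩
      simp only [hc]; omega
    | leave i => exact ⟨hk, Or.inl trivial⟩
    | step k l h => exact ⟨trivial, Or.inr (by simp only [hc]; omega)⟩
    | back k l hk0 hl =>
      exact ⟨Fin.lt_def.2 (by omega), Or.inl hk0⟩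
  have hall : ∀ k, good (π k) := by
    intro k
    induction k with
    | zero => exact Fin.lt_def.2 (Nat.pos_of_ne_zero hj0)
    | succ k ih => exact (hstep k ih).1
  refine mem_uniformBuchi_of_rank (fun k => c (π k)) 0 (fun k _ => ?_)
    fun k _ => (hstep k (hall k)).2
  have := hall k
  generalize π k = v at this
  rcases v with k | i | i | k <;> simp only [hgood, hc, Fin.lt_def] at this ⊢ <;> omega

end DelayVertex

theorem mainTheorem3 :
    (∀ (V : Type u) [Countable V] (A : Arena V) (F : Set V) (N : ℕ),
      (∃ σ : A.Strategy Player.eve, σ.IsPositional ∧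
        A.EveWins (uniformBuchi F N) σ (A.eveWinningSet (uniformBuchi F N))) ∧
      (∃ (μ : MemoryStructure V (Fin (N + 1))) (τ : A.Strategy Player.adam), τ.UsesMemory μ ∧
        A.AdamWins (uniformBuchi F N) τ (A.adamWinningSet (uniformBuchi F N)))) ∧
    (∀ N : ℕ, 2 ≤ N →
      ∃ (V : Type) (_ : Finite V) (A : Arena V) (F : Set V),
        ∃ v₀ ∈ A.adamWinningSet (uniformBuchi F N),
          ∀ (M : Type w) [Fintype M] (μ : MemoryStructure V M) (τ : A.Strategy Player.adam),
            τ.UsesMemory μ → A.AdamWins (uniformBuchi F N) τ {v₀} →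
              N - 1 ≤ Fintype.card M) :=
  ⟨fun _ _ A F N => A.uniformBuchi_strategies F N, fun _ hN =>
    ⟨_, inferInstance, DelayVertex.arena hN, _, _, DelayVertex.start_mem_adamWinningSet hN,
      fun _ _ μ τ => DelayVertex.le_card_memory hN μ τ⟩⟩
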